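/- **Proposition 3.2.** For $c>0$ let $Lv(c)$ denote the one-sided Lévy distribution on $\mathbb R$, with cumulative distribution function $F(x;c)=0$ for $x\le 0$ and $F(x;c)=2-2\Phi(\sqrt{c/x})$ for $x>0$, where $\Phi$ is the standard normal distribution function. For $0\le a<b<1$ let $$\mu_{Lv(1)}(a,b)=\mathbb E\big[W\,\big|\,W\in[F_W^{-1}(a),F_W^{-1}(b)]\big],\qquad W\sim Lv(1),$$ where $F_W^{-1}(p)=\inf\{x\in\mathbb R: F_W(x)\ge p\}\in[-\infty,\infty]$ is the generalised inverse of the distribution function of $W$. For a sample $X_1,\dots,X_n$ with order statistics $X_{(1)}\le\dots\le X_{(n)}$ put $$\hat\mu_X(a,b)=\frac{1}{[nb]-[na]}\sum_{i=[na]+1}^{[nb]}X_{(i)},\qquad \hat c_{\mathrm{QCM}}(a,b)=\frac{\hat\mu_X(a,b)}{\mu_{Lv(1)}(a,b)},$$ where $[x]$ is the integer part of $x$ (these are well defined for all sufficiently large $n$). Let $0\le a_1<b_1<1$ and $0\le a_2<b_2<1$ with $(a_1,b_1)\ne(a_2,b_2)$. Then there is a constant $\tau_O>0$, depending only on $a_1,b_1,a_2,b_2$,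 such that for every $c>0$ and every sequence $X_1,X_2,\dots$ of i.i.d. random variables following $Lv(c)$, the statistics $$O_n=\sqrt n\left(\frac{\hat c_{\mathrm{QCM}}(a_1,b_1)}{\hat c_{\mathrm{QCM}}(a_2,b_2)}-1\right)$$ computed from $X_1,\dots,X_n$ satisfy $O_n\overset{d}{\to}\mathcal N(0,\tau_O^2)$ as $n\to\infty$. In particular, $\tau_O$ does not depend on $c$. -/

import Mathlib

open MeasureTheory ProbabilityTheory Filter Set Topology
open scoped NNReal

namespace LevyQCM

noncomputable section

/-! ## The one-sided Lévy distribution -/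

/-- The standard normal cumulative distribution function `Φ`. -/
def stdNormalCDF (x : ℝ) : ℝ := cdf (gaussianReal 0 1) x

/-- The function `F(x; c)`, equal to `0` for `x ≤ 0` and to `2 - 2 Φ(√(c / x))` for `x > 0`. -/
def levyCDF (c x : ℝ) : ℝ :=
  if x ≤ 0 then 0 else 2 - 2 * stdNormalCDF (√(c / x))

lemma stdNormalCDF_mono : Monotone stdNormalCDF := monotone_cdf _

lemma continuous_stdNormalCDF : Continuous stdNormalCDF := by
  rw [continuous_iff_continuousAt]
  intro x
  have hm : Monotone (cdf (gaussianReal 0 1)) := monotone_cdf _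
  refine (hm.continuousAt_iff_leftLim_eq_rightLim).2 ?_
  have h0 : (cdf (gaussianReal 0 1)).measure {x} = 0 := by
    rw [measure_cdf]
    have := nullSingletonClass_gaussianReal (μ := 0) (v := 1) one_ne_zero
    exact measure_singleton x
  rw [StieltjesFunction.measure_singleton, ENNReal.ofReal_eq_zero] at h0
  have h1 := hm.leftLim_le (le_refl x)
  rw [StieltjesFunction.rightLim_eq]
  linarith

lemma stdNormalCDF_zero : stdNormalCDF 0 = 1 / 2 := by
  have hna := nullSingletonClass_gaussianReal (μ := 0) (v := 1) one_ne_zero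
  have h1 : (gaussianReal 0 1).real (Ici 0) = (gaussianReal 0 1).real (Iic 0) := by
    have h : (gaussianReal 0 1).map (fun x : ℝ => -x) = gaussianReal 0 1 := by
      simpa using gaussianReal_map_neg (μ := 0) (v := 1)
    conv_lhs => rw [← h]
    rw [map_measureReal_apply measurable_neg measurableSet_Ici]
    congr 1
    ext x
    simp
  have h2 : (gaussianReal 0 1).real (Ioi 0) = (gaussianReal 0 1).real (Ici 0) :=
    measureReal_congr Ioi_ae_eq_Ici
  have h3 := probReal_compl_eq_one_sub (μ := gaussianReal 0 1) (measurableSet_Iic (a := (0 : ℝ)))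
  rw [compl_Iic, h2, h1] at h3
  rw [stdNormalCDF, cdf_eq_real]
  linarith

lemma levyCDF_of_nonpos (c : ℝ) {x : ℝ} (hx : x ≤ 0) : levyCDF c x = 0 := if_pos hx

lemma levyCDF_of_pos (c : ℝ) {x : ℝ} (hx : 0 < x) :
    levyCDF c x = 2 - 2 * stdNormalCDF (√(c / x)) := if_neg hx.not_ge

lemma levyCDF_mono {c : ℝ} (hc : 0 < c) : Monotone (levyCDF c) := by
  intro x y hxy
  rcases le_or_gt y 0 with hy | hy
  · rw [levyCDF_of_nonpos c hy, levyCDF_of_nonpos c (hxy.trans hy)]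
  rcases le_or_gt x 0 with hx | hx
  · rw [levyCDF_of_nonpos c hx, levyCDF_of_pos c hy]
    have := cdf_le_one (gaussianReal 0 1) (√(c / y))
    rw [stdNormalCDF]
    linarith
  · rw [levyCDF_of_pos c hx, levyCDF_of_pos c hy]
    have : stdNormalCDF (√(c / y)) ≤ stdNormalCDF (√(c / x)) :=
      stdNormalCDF_mono (Real.sqrt_le_sqrt (by gcongr))
    linarith

lemma levyCDF_rightCts {c : ℝ} (hc : 0 < c) (x : ℝ) :
    ContinuousWithinAt (levyCDF c) (Ici x) x := by
  rcases lt_trichotomy x 0 with hx | rfl | hx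
  · refine ContinuousAt.continuousWithinAt ?_
    refine (continuousAt_const (y := (0 : ℝ))).congr ?_
    filter_upwards [Iio_mem_nhds hx] with y hy
    exact (levyCDF_of_nonpos c (le_of_lt hy)).symm
  · refine continuousWithinAt_Ioi_iff_Ici.1 ?_
    rw [ContinuousWithinAt, levyCDF_of_nonpos c le_rfl]
    have h1 : Tendsto (fun y : ℝ => √(c / y)) (𝓝[>] 0) atTop := by
      refine Real.tendsto_sqrt_atTop.comp ?_
      have h := (tendsto_inv_nhdsGT_zero (𝕜 := ℝ)).const_mul_atTop hc
      exact h.congr fun y => (div_eq_mul_inv c y).symm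
    have h2 : Tendsto (fun y : ℝ => 2 - 2 * stdNormalCDF (√(c / y))) (𝓝[>] 0) (𝓝 0) := by
      have := ((tendsto_cdf_atTop (gaussianReal 0 1)).comp h1).const_mul 2 |>.const_sub 2
      simpa [stdNormalCDF] using! this
    refine h2.congr' ?_
    filter_upwards [self_mem_nhdsWithin] with y hy
    exact (levyCDF_of_pos c hy).symm
  · refine ContinuousAt.continuousWithinAt ?_
    have h : ContinuousAt (fun y : ℝ => 2 - 2 * stdNormalCDF (√(c / y))) x := by
      have h1 : ContinuousAt (fun y : ℝ => √(c / y)) x :=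
        (continuousAt_const.div continuousAt_id hx.ne').sqrt
      have h2 : ContinuousAt (fun y : ℝ => stdNormalCDF (√(c / y))) x :=
        ContinuousAt.comp (f := fun y : ℝ => √(c / y)) (g := stdNormalCDF)
          continuous_stdNormalCDF.continuousAt h1
      exact continuousAt_const.sub (continuousAt_const.mul h2)
    refine h.congr ?_
    filter_upwards [Ioi_mem_nhds hx] with y hy
    exact (levyCDF_of_pos c hy).symm

lemma tendsto_levyCDF_atBot (c : ℝ) : Tendsto (levyCDF c) atBot (𝓝 0) := by
  refine tendsto_const_nhds.congr' ?_
  filter_upwards [eventually_le_atBot 0] with y hy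
  exact (levyCDF_of_nonpos c hy).symm

lemma tendsto_levyCDF_atTop (c : ℝ) : Tendsto (levyCDF c) atTop (𝓝 1) := by
  have h1 : Tendsto (fun y : ℝ => √(c / y)) atTop (𝓝 0) := by
    have := (Real.continuous_sqrt.tendsto 0).comp
      (tendsto_id.const_div_atTop c : Tendsto (fun y : ℝ => c / y) atTop (𝓝 0))
    simpa using! this
  have h2 : Tendsto (fun y : ℝ => 2 - 2 * stdNormalCDF (√(c / y))) atTop (𝓝 1) := by
    have := ((continuous_stdNormalCDF.tendsto 0).comp h1).const_mul 2 |>.const_sub 2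
    rw [stdNormalCDF_zero] at this
    norm_num at this
    exact this
  refine h2.congr' ?_
  filter_upwards [eventually_gt_atTop 0] with y hy
  exact (levyCDF_of_pos c hy).symm

/-- The function `F(·; c)`, `c > 0`, bundled as a non-decreasing right-continuous function. -/
def levyStieltjes (c : ℝ) (hc : 0 < c) : StieltjesFunction ℝ where
  toFun := levyCDF c
  mono' := levyCDF_mono hc
  right_continuous' := levyCDF_rightCts hc

/-- The one-sided Lévy distribution `Lv(c)`, `c > 0`: the law on `ℝ` whose cumulative
distribution function is `F(·; c)`. -/
def levyMeasure (c : ℝ) (hc : 0 < c) : Measure ℝ := (levyStieltjes c hc).measure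

instance (c : ℝ) (hc : 0 < c) : IsProbabilityMeasure (levyMeasure c hc) :=
  ⟨by rw [levyMeasure, StieltjesFunction.measure_univ _ (tendsto_levyCDF_atBot c)
    (tendsto_levyCDF_atTop c)]; simp⟩

/-- `levyMeasure c` does have the cumulative distribution function `F(·; c)`. -/
theorem cdf_levyMeasure (c : ℝ) (hc : 0 < c) (x : ℝ) :
    cdf (levyMeasure c hc) x = levyCDF c x := by
  rw [levyMeasure, cdf_measure_stieltjesFunction _ (tendsto_levyCDF_atBot c)
    (tendsto_levyCDF_atTop c)]
  rfl

/-! ## Quantile conditional mean -/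

/-- The generalised inverse `F⁻¹(p) = inf {x | p ≤ F(x)}` of the cumulative distribution function
of a law `ν` on `ℝ`. It takes values in `[-∞, ∞]`, so that `F⁻¹(0) = -∞`. -/
def quantile (ν : Measure ℝ) (p : ℝ) : EReal :=
  sInf ((fun x : ℝ => (x : EReal)) '' {x : ℝ | p ≤ cdf ν x})

/-- The interval `[F⁻¹(a), F⁻¹(b)]` (as a set of reals); a variable `X` with law `ν` is
conditioned on the event that `X` belongs to it. -/
def quantileSet (ν : Measure ℝ) (a b : ℝ) : Set ℝ :=
  {x : ℝ | quantile ν a ≤ (x : EReal) ∧ (x : EReal) ≤ quantile ν b}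

/-- The quantile conditional mean `μ_X(a, b) = E[X | X ∈ [F⁻¹(a), F⁻¹(b)]]` of a variable `X`
with law `ν`. -/
def qcMean (ν : Measure ℝ) (a b : ℝ) : ℝ :=
  ∫ x, x ∂(cond ν (quantileSet ν a b))

/-! ## Estimators and the test statistic -/

/-- The order statistics of a sample `x` of size `n`, in non-decreasing order. With indices
starting from `0`, `orderStat x i` is the order statistic number `i + 1`. -/
def orderStat {n : ℕ} (x : Fin n → ℝ) (i : Fin n) : ℝ := x (Tuple.sort x i)

/-- The sample quantile conditional mean `([nb] - [na])⁻¹ ∑_{i = [na] + 1}^{[nb]} x_(i)`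
(for `0 ≤ a < b`). -/
def sampleQCMean {n : ℕ} (x : Fin n → ℝ) (a b : ℝ) : ℝ :=
  1 / ((⌊n * b⌋₊ : ℝ) - (⌊n * a⌋₊ : ℝ)) *
    ∑ i ∈ Finset.univ.filter
        (fun i : Fin n => ⌊n * a⌋₊ + 1 ≤ (i : ℕ) + 1 ∧ (i : ℕ) + 1 ≤ ⌊n * b⌋₊),
      orderStat x i

/-- The scale estimator `ĉ_QCM(a, b)`: the sample quantile conditional mean, normalised by the
quantile conditional mean of `Lv(1)`. -/
def scaleQCM {n : ℕ} (x : Fin n → ℝ) (a b : ℝ) : ℝ :=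
  sampleQCMean x a b / qcMean (levyMeasure 1 one_pos) a b

/-- The statistic `O_n = √n (ĉ_QCM(a₁, b₁) / ĉ_QCM(a₂, b₂) - 1)` of a sample of size `n`. -/
def statO {n : ℕ} (x : Fin n → ℝ) (a₁ b₁ a₂ b₂ : ℝ) : ℝ :=
  √(n : ℝ) * (scaleQCM x a₁ b₁ / scaleQCM x a₂ b₂ - 1)

end

end LevyQCM

/-! The sum of the `k` smallest sample values is the maximum over `t` of `k t - ∑ (t - x i)⁺`,
attained at the `k`-th order statistic. With `k = ⌊n F(q)⌋`, replacing that random maximiser by the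
true quantile `q` costs at most the distance between the two times `|k - #{x i ≤ q}|`, that is
`o_P(1) · O_P(√n)` (`partialSumGap_le`, `tendstoInMeasure_partialSumGap`). So trimmed sums of order
statistics are, up to `o_P(√n)`, i.i.d. sums.

For `a = F(p)` and `b = F(q)`, subtracting two such sums leaves the summand `ramp p q`, which is
bounded although the Lévy law has no mean. Hence `√n (μ̂ - μ)` equals `-(b - a)⁻¹` times the
normalised sum of `ramp p q`, up to `o_P(1)` (`tendstoInMeasure_sampleQCMean`). The difference of
the two normalised means is then governed by the single bounded function `influence`, to which the
central limit theorem applies. The denominator tends to `1` in probability, so Slutsky's theorem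
passes from the difference to the ratio (`tendstoInDistribution_ratio`).

The limit variance is positive: were `influence` almost surely constant, continuity and full support
would make two positively weighted ramps coincide on `[0, ∞)`, and the break points of a ramp can be
read off from it (`variance_influence_pos`). The scale `c` disappears because the statistic is scale
invariant and `c⁻¹ X` follows `Lv(1)` (`statO_mul`, `map_inv_mul_levyMeasure`).

Everything before the final theorem, apart from the facts on the Lévy law itself, is done for an
arbitrary law satisfying `IsFullNonneg`. -/

namespace LevyQCM
-- Convergence and boundedness in probability.
section Stochastic
open scoped ENNReal

variable {Ω : Type*} {mΩ : MeasurableSpace Ω} {P : Measure Ω}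

/-- A sequence of real random variables that is bounded in probability. -/
def StochBdd (P : Measure Ω) (A : ℕ → Ω → ℝ) : Prop :=
  ∀ ε : ℝ≥0∞, 0 < ε → ∃ K : ℝ, ∀ n, P {ω | K ≤ |A n ω|} ≤ ε

lemma tendstoInMeasure_zero_iff {f : ℕ → Ω → ℝ} :
    TendstoInMeasure P f atTop 0 ↔
      ∀ ε : ℝ, 0 < ε → Tendsto (fun n => P {ω | ε ≤ |f n ω|}) atTop (𝓝 0) := by
  simp [tendstoInMeasure_iff_norm]

lemma tendstoInMeasure_const_iff {f : ℕ → Ω → ℝ} {c : ℝ} :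
    TendstoInMeasure P f atTop (fun _ => c) ↔
      TendstoInMeasure P (fun n ω => f n ω - c) atTop 0 := by
  simp [tendstoInMeasure_iff_norm]

/-- The common form of all remainder estimates below: for each `δ` the remainder is at most `δ ·
O_P(1)`, outside events of vanishing probability that may depend on `δ`. -/
lemma tendstoInMeasure_zero_of_abs_le {R A : ℕ → Ω → ℝ} (hA : StochBdd P A)
    (h : ∀ δ : ℝ, 0 < δ → ∃ B : ℕ → Set Ω, Tendsto (fun n => P (B n)) atTop (𝓝 0) ∧
      ∀ᶠ n in atTop, ∀ ω, ω ∉ B n → |R n ω| ≤ δ * (1 + |A n ω|)) :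
    TendstoInMeasure P R atTop 0 := by
  rw [tendstoInMeasure_zero_iff]
  intro ε hε
  rw [ENNReal.tendsto_atTop_zero]
  intro η hη
  have hη2 : 0 < η / 2 := ENNReal.half_pos hη.ne'
  obtain ⟨K, hK⟩ := hA (η / 2) hη2
  obtain ⟨B, hB, hR⟩ := h (ε / (1 + |K|)) (by positivity)
  rw [← eventually_atTop]
  filter_upwards [hR, (ENNReal.tendsto_nhds_zero.1 hB) (η / 2) hη2] with n hn hBn
  calc P {ω | ε ≤ |R n ω|} ≤ P (B n ∪ {ω | K ≤ |A n ω|}) := by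
        refine measure_mono fun ω hω => ?_
        by_contra hcon
        simp only [mem_union, mem_ofPred_eq, not_or, not_le] at hcon
        have h1 := hn ω hcon.1
        have h2 : ε / (1 + |K|) * (1 + |A n ω|) < ε / (1 + |K|) * (1 + |K|) := by
          have := le_abs_self K
          gcongr
          linarith [hcon.2]
        rw [div_mul_cancel₀ _ (by positivity)] at h2
        have h3 : ε ≤ |R n ω| := hω
        linarith
    _ ≤ P (B n) + P {ω | K ≤ |A n ω|} := measure_union_le _ _
    _ ≤ η / 2 + η / 2 := add_le_add hBn (hK n)
    _ = η := ENNReal.add_halves η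

lemma stochBdd_const [IsFiniteMeasure P] (c : ℝ) : StochBdd P (fun _ _ => c) :=
  fun ε _ => ⟨|c| + 1, fun n => by simp [show ¬ ((1 : ℝ) ≤ 0) by norm_num]⟩

lemma TendstoInMeasure.add_zero {f g : ℕ → Ω → ℝ} (hf : TendstoInMeasure P f atTop 0)
    (hg : TendstoInMeasure P g atTop 0) :
    TendstoInMeasure P (fun n ω => f n ω + g n ω) atTop 0 := by
  rw [tendstoInMeasure_zero_iff] at *
  intro ε hε
  have h := (hf (ε / 2) (by positivity)).add (hg (ε / 2) (by positivity))
  rw [_root_.add_zero] at h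
  refine tendsto_of_tendsto_of_tendsto_of_le_of_le tendsto_const_nhds h (fun _ => zero_le) ?_
  intro n
  refine (measure_mono fun ω hω => ?_).trans (measure_union_le _ _)
  by_contra hcon
  simp only [mem_union, mem_ofPred_eq, not_or, not_le] at hcon hω
  linarith [abs_add_le (f n ω) (g n ω)]

lemma TendstoInMeasure.stochBdd_mul {A B : ℕ → Ω → ℝ} (hB : TendstoInMeasure P B atTop 0)
    (hA : StochBdd P A) : TendstoInMeasure P (fun n ω => A n ω * B n ω) atTop 0 := by
  refine tendstoInMeasure_zero_of_abs_le hA fun δ hδ =>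
    ⟨fun n => {ω | δ ≤ |B n ω|}, tendstoInMeasure_zero_iff.1 hB δ hδ, .of_forall ?_⟩
  intro n ω hω
  simp only [mem_ofPred_eq, not_le] at hω
  rw [abs_mul, mul_comm]
  exact mul_le_mul hω.le (by linarith) (abs_nonneg _) hδ.le

lemma tendstoInMeasure_zero_of_tendsto [IsFiniteMeasure P] {u : ℕ → ℝ}
    (hu : Tendsto u atTop (𝓝 0)) : TendstoInMeasure P (fun n (_ : Ω) => u n) atTop 0 := by
  refine tendstoInMeasure_of_tendsto_ae (fun n => aestronglyMeasurable_const) ?_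
  exact .of_forall fun ω => hu

lemma TendstoInMeasure.const_mul_zero [IsFiniteMeasure P] {f : ℕ → Ω → ℝ}
    (hf : TendstoInMeasure P f atTop 0) (c : ℝ) :
    TendstoInMeasure P (fun n ω => c * f n ω) atTop 0 :=
  TendstoInMeasure.stochBdd_mul hf (stochBdd_const c)

/-- Where `f n` is within `1/2` of `1`, inversion at most doubles the distance to `1`; the
convention `0⁻¹ = 0` only matters outside that event. -/
lemma TendstoInMeasure.inv_one {f : ℕ → Ω → ℝ}
    (hf : TendstoInMeasure P f atTop (fun _ => 1)) :
    TendstoInMeasure P (fun n ω => (f n ω)⁻¹) atTop (fun _ => 1) := by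
  rw [tendstoInMeasure_const_iff, tendstoInMeasure_zero_iff] at *
  intro ε hε
  refine tendsto_of_tendsto_of_tendsto_of_le_of_le tendsto_const_nhds
    (hf (min (1 / 2) (ε / 2)) (by positivity)) (fun _ => zero_le) fun n => measure_mono ?_
  intro ω hω
  simp only [mem_ofPred_eq] at hω ⊢
  by_contra! hcon
  have h1 := hcon.trans_le (min_le_left _ _)
  have h2 := hcon.trans_le (min_le_right _ _)
  rw [abs_lt] at h1
  have hpos : 1 / 2 < f n ω := by linarith
  have : (f n ω)⁻¹ - 1 = -((f n ω - 1) / f n ω) := by field_simp; ring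
  rw [this, abs_neg, abs_div, abs_of_pos (by linarith : 0 < f n ω), le_div_iff₀ (by linarith)] at hω
  nlinarith

/-- The centred and normalised sum `n^{-1/2} (∑_{i < n} g (X i) - n E g)`, where the expectation
is with respect to `ν`. -/
noncomputable def normSum (ν : Measure ℝ) (X : ℕ → Ω → ℝ) (g : ℝ → ℝ) (n : ℕ) (ω : Ω) : ℝ :=
  (√(n : ℝ))⁻¹ * (∑ i ∈ Finset.range n, g (X i ω) - n * ∫ x, g x ∂ν)

/-! ### Normalised i.i.d. sums of bounded functions: Chebyshev bounds and the central limit theorem.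
-/

section iid

variable [IsProbabilityMeasure P] {ν : Measure ℝ} [IsProbabilityMeasure ν] {X : ℕ → Ω → ℝ}
  {g : ℝ → ℝ}

lemma memLp_of_abs_le (hg : Measurable g) {C : ℝ} (hC : ∀ x, |g x| ≤ C) (p : ℝ≥0∞) :
    MemLp g p ν :=
  MemLp.of_bound hg.aestronglyMeasurable C (.of_forall hC)

/-- Chebyshev's inequality. The bound does not depend on `n`, so it yields both tightness and, with
`K` of order `√n`, a weak law of large numbers. -/
lemma meas_normSum_le (hX : ∀ i, HasLaw (X i) ν P) (hind : iIndepFun X P) (hg : Measurable g)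
    {C : ℝ} (hC : ∀ x, |g x| ≤ C) {K : ℝ} (hK : 0 < K) (n : ℕ) :
    P {ω | K ≤ |normSum ν X g n ω|} ≤ ENNReal.ofReal (variance g ν / K ^ 2) := by
  have hLp := memLp_of_abs_le (ν := ν) hg hC 2
  have hLpX : ∀ i, MemLp (fun ω => g (X i ω)) 2 P := fun i => by
    have h1 : MemLp g 2 (P.map (X i)) := by rw [(hX i).map_eq]; exact hLp
    exact h1.comp_of_map (hX i).aemeasurable
  have hE : ∀ i, ∫ ω, g (X i ω) ∂P = ∫ x, g x ∂ν := fun i =>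
    (hX i).integral_comp hg.aestronglyMeasurable
  have hV : ∀ i, variance (fun ω => g (X i ω)) P = variance g ν := fun i => by
    have := variance_map (X := g) (Y := X i) (μ := P)
      (by rw [(hX i).map_eq]; exact hg.aemeasurable) (hX i).aemeasurable
    rw [(hX i).map_eq] at this
    rw [this]; rfl
  rcases Nat.eq_zero_or_pos n with rfl | hn
  · have : {ω | K ≤ |normSum ν X g 0 ω|} = ∅ := by
      ext ω; simp [normSum, hK]
    rw [this]; simp
  have hn' : 0 < √(n : ℝ) := Real.sqrt_pos.2 (by exact_mod_cast hn)
  set S : Ω → ℝ := fun ω => ∑ i ∈ Finset.range n, g (X i ω) with hS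
  have hSLp : MemLp S 2 P := memLp_finsetSum _ fun i _ => hLpX i
  have hSE : ∫ ω, S ω ∂P = n * ∫ x, g x ∂ν := by
    rw [hS, integral_finsetSum _ fun i _ => (hLpX i).integrable (by simp)]
    simp [hE]
  have hSV : variance S P = n * variance g ν := by
    have h := IndepFun.variance_sum (s := Finset.range n) (X := fun i ω => g (X i ω))
      (μ := P) (fun i _ => hLpX i)
      (fun i _ j _ hij => (hind.indepFun hij).comp hg hg)
    simp only [hV, Finset.sum_const, Finset.card_range, nsmul_eq_mul] at h
    rw [← h]; congr 1; ext ω; simp [hS]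
  have h := meas_ge_le_variance_div_sq hSLp (mul_pos hK hn')
  rw [hSE, hSV, mul_pow, Real.sq_sqrt (Nat.cast_nonneg n)] at h
  have hn0 : (n : ℝ) ≠ 0 := by exact_mod_cast hn.ne'
  have e1 : (n : ℝ) * variance g ν / (K ^ 2 * n) = variance g ν / K ^ 2 := by field_simp
  rw [e1] at h
  refine (measure_mono fun ω hω => ?_).trans h
  simp only [mem_ofPred_eq, normSum, abs_mul, abs_inv, abs_of_pos hn'] at hω ⊢
  rwa [inv_mul_eq_div, le_div_iff₀ hn'] at hω

lemma stochBdd_normSum (hX : ∀ i, HasLaw (X i) ν P) (hind : iIndepFun X P) (hg : Measurable g)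
    {C : ℝ} (hC : ∀ x, |g x| ≤ C) : StochBdd P (normSum ν X g) := by
  intro ε hε
  have h1 : Tendsto (fun K : ℝ => ENNReal.ofReal (variance g ν / K ^ 2)) atTop (𝓝 0) := by
    rw [← ENNReal.ofReal_zero]
    exact ENNReal.tendsto_ofReal (tendsto_const_nhds.div_atTop (tendsto_pow_atTop two_ne_zero))
  obtain ⟨K, hK, hK0⟩ := (((ENNReal.tendsto_nhds_zero.1 h1) ε hε).and
    (eventually_gt_atTop 0)).exists
  exact ⟨K, fun n => (meas_normSum_le hX hind hg hC hK0 n).trans hK⟩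

lemma tendsto_meas_normSum_ge (hX : ∀ i, HasLaw (X i) ν P) (hind : iIndepFun X P)
    (hg : Measurable g) {C : ℝ} (hC : ∀ x, |g x| ≤ C) {d : ℝ} (hd : 0 < d) :
    Tendsto (fun n : ℕ => P {ω | √n * d ≤ |normSum ν X g n ω|}) atTop (𝓝 0) := by
  have hs : Tendsto (fun n : ℕ => √(n : ℝ) * d) atTop atTop :=
    (Real.tendsto_sqrt_atTop.comp tendsto_natCast_atTop_atTop).atTop_mul_const hd
  have h1 : Tendsto (fun n : ℕ => ENNReal.ofReal (variance g ν / (√(n : ℝ) * d) ^ 2)) atTop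
      (𝓝 0) := by
    rw [← ENNReal.ofReal_zero]
    exact ENNReal.tendsto_ofReal
      (tendsto_const_nhds.div_atTop ((tendsto_pow_atTop two_ne_zero).comp hs))
  refine tendsto_of_tendsto_of_tendsto_of_le_of_le' tendsto_const_nhds h1
    (.of_forall fun _ => zero_le) ?_
  filter_upwards [hs.eventually_gt_atTop 0] with n hn
  exact meas_normSum_le hX hind hg hC hn n

lemma tendstoInDistribution_normSum (hX : ∀ i, HasLaw (X i) ν P) (hind : iIndepFun X P)
    (hg : Measurable g) {C : ℝ} (hC : ∀ x, |g x| ≤ C) :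
    TendstoInDistribution (normSum ν X g) atTop (id : ℝ → ℝ) (fun _ => P)
      (gaussianReal 0 (variance g ν).toNNReal) := by
  have hLp := memLp_of_abs_le (ν := ν) hg hC 2
  have hE : ∫ ω, g (X 0 ω) ∂P = ∫ x, g x ∂ν :=
    (hX 0).integral_comp hg.aestronglyMeasurable
  have hV : variance (fun ω => g (X 0 ω)) P = variance g ν := by
    have := variance_map (X := g) (Y := X 0) (μ := P)
      (by rw [(hX 0).map_eq]; exact hg.aemeasurable) (hX 0).aemeasurable
    rw [(hX 0).map_eq] at this
    rw [this]; rfl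
  have h := tendstoInDistribution_inv_sqrt_mul_sum_sub (P := P) (X := fun i ω => g (X i ω))
    (P' := gaussianReal 0 (variance g ν).toNNReal) (Y := id)
    (by simp only [hV]; exact HasLaw.id)
    (by
      have h1 : MemLp g 2 (P.map (X 0)) := by rw [(hX 0).map_eq]; exact hLp
      exact h1.comp_of_map (hX 0).aemeasurable)
    (hind.comp (fun _ => g) fun _ => hg)
    (fun i => ⟨hg.comp_aemeasurable (hX i).aemeasurable, hg.comp_aemeasurable (hX 0).aemeasurable,
      by
        have e : ∀ j, P.map (fun ω => g (X j ω)) = ν.map g := fun j => by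
          rw [← (hX j).map_eq, AEMeasurable.map_map_of_aemeasurable hg.aemeasurable
            (hX j).aemeasurable]
          rfl
        rw [e, e]⟩)
  simp only [hE] at h
  exact h

end iid

end Stochastic

/-! ### Deterministic facts on order statistics and their partial sums. -/

section OrderStatistics

variable {n : ℕ}

/-- The sum of the `k` smallest elements of a sample. -/
noncomputable def partialSum (x : Fin n → ℝ) (k : ℕ) : ℝ :=
  ∑ i ∈ Finset.univ.filter (fun i : Fin n => (i : ℕ) < k), orderStat x i

/-- The number of elements of a sample that are at most `t`. -/
noncomputable def countLE (x : Fin n → ℝ) (t : ℝ) : ℝ :=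
  ∑ i, (Iic t).indicator 1 (x i)

/-- The error of approximating `partialSum x k` by its lower bound `k t - ∑ i, (t - x i)⁺`. -/
noncomputable def partialSumGap (x : Fin n → ℝ) (k : ℕ) (t : ℝ) : ℝ :=
  partialSum x k - (k * t - ∑ i, max (t - x i) 0)

lemma orderStat_mono (x : Fin n → ℝ) : Monotone (orderStat x) := Tuple.monotone_sort x

lemma sum_comp_orderStat (x : Fin n → ℝ) (g : ℝ → ℝ) : ∑ i, g (orderStat x i) = ∑ i, g (x i) :=
  Equiv.sum_comp (Tuple.sort x) fun i => g (x i)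

lemma orderStat_mul (x : Fin n → ℝ) {c : ℝ} (hc : 0 ≤ c) (i : Fin n) :
    orderStat (fun j => c * x j) i = c * orderStat x i := by
  have h : Monotone ((fun j => c * x j) ∘ Tuple.sort x) := fun i j hij =>
    mul_le_mul_of_nonneg_left (orderStat_mono x hij) hc
  exact (congrFun (Tuple.comp_sort_eq_comp_iff_monotone.2 h) i).symm

lemma sampleQCMean_mul (x : Fin n → ℝ) {c : ℝ} (hc : 0 ≤ c) (a b : ℝ) :
    sampleQCMean (fun j => c * x j) a b = c * sampleQCMean x a b := by
  simp only [sampleQCMean, orderStat_mul x hc, ← Finset.mul_sum]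
  ring

lemma statO_mul (x : Fin n → ℝ) {c : ℝ} (hc : 0 < c) (a₁ b₁ a₂ b₂ : ℝ) :
    statO (fun j => c * x j) a₁ b₁ a₂ b₂ = statO x a₁ b₁ a₂ b₂ := by
  rw [statO, statO]
  simp only [scaleQCM, sampleQCMean_mul x hc.le]
  rw [mul_div_assoc c (sampleQCMean x a₁ b₁), mul_div_assoc c (sampleQCMean x a₂ b₂), mul_div_mul_left _ _ hc.ne']

lemma sum_filter_lt_const {k : ℕ} (hk : k ≤ n) (t : ℝ) :
    ∑ _i ∈ Finset.univ.filter (fun i : Fin n => (i : ℕ) < k), t = k * t := by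
  rw [Finset.sum_const, nsmul_eq_mul]
  congr 2
  rw [Fin.card_filter_val_lt]
  exact min_eq_right hk

lemma partialSumGap_nonneg (x : Fin n → ℝ) {k : ℕ} (hk : k ≤ n) (t : ℝ) :
    0 ≤ partialSumGap x k t := by
  rw [partialSumGap, ← sum_comp_orderStat x fun y => max (t - y) 0, partialSum,
    ← sum_filter_lt_const hk t]
  have h1 : ∑ i ∈ Finset.univ.filter (fun i : Fin n => (i : ℕ) < k), (t - orderStat x i) ≤
      ∑ i, max (t - orderStat x i) 0 := by
    refine (Finset.sum_le_sum fun i _ => le_max_left _ 0).trans ?_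
    exact Finset.sum_le_sum_of_subset_of_nonneg (Finset.filter_subset _ _)
      fun _ _ _ => le_max_right _ _
  rw [Finset.sum_sub_distrib] at h1
  linarith

lemma countLE_eq_card (x : Fin n → ℝ) (t : ℝ) :
    countLE x t = ((Finset.univ.filter fun i => orderStat x i ≤ t).card : ℝ) := by
  rw [countLE, ← sum_comp_orderStat x ((Iic t).indicator 1), Finset.card_filter]
  push_cast
  refine Finset.sum_congr rfl fun i _ => ?_
  simp [indicator_apply]

/-- Turns bounds on the empirical distribution function into bounds on order statistics; it also
gives their measurability. -/
lemma orderStat_le_iff (x : Fin n → ℝ) (i : Fin n) (t : ℝ) :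
    orderStat x i ≤ t ↔ ((i : ℕ) : ℝ) + 1 ≤ countLE x t := by
  rw [countLE_eq_card, ← Tuple.lt_card_le_iff_apply_le_of_monotone (orderStat_mono x),
    ← Nat.cast_add_one, Nat.cast_le, Nat.succ_le_iff]

/-- The lower bound is exact at the `k`-th order statistic `v`, and the counting hypotheses put `v`
within `δ` of `t`. Convexity of `t ↦ ∑ (t - x i)⁺` then bounds the gap by `(v - t) (k - countLE x
t)`. -/
lemma partialSumGap_le (x : Fin n → ℝ) {k : ℕ} (hk0 : 0 < k) (hk : k ≤ n) {t δ : ℝ}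
    (h1 : countLE x (t - δ) < k) (h2 : k ≤ countLE x (t + δ)) :
    |partialSumGap x k t| ≤ δ * |k - countLE x t| := by
  rw [abs_of_nonneg (partialSumGap_nonneg x hk t)]
  set v := orderStat x ⟨k - 1, by omega⟩ with hv
  have hk' : (((k - 1 : ℕ) : ℝ)) + 1 = k := by
    rw [← Nat.cast_add_one]; congr 1; omega
  have hv1 : t - δ < v := by
    rw [← not_le, hv, orderStat_le_iff, hk', not_le]; exact h1
  have hv2 : v ≤ t + δ := by
    rw [hv, orderStat_le_iff, hk']; exact h2
  -- At `v` the first `k` positive parts are the differences themselves and the others vanish, so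
  -- the bound is an equality.
  have hS : partialSum x k = k * v - ∑ i, max (v - x i) 0 := by
    rw [← sum_comp_orderStat x fun y => max (v - y) 0, partialSum, ← sum_filter_lt_const hk v,
      ← Finset.sum_filter_add_sum_filter_not Finset.univ (fun i : Fin n => (i : ℕ) < k)
        (fun i => max (v - orderStat x i) 0)]
    have e1 : ∑ i ∈ Finset.univ.filter (fun i : Fin n => (i : ℕ) < k), max (v - orderStat x i) 0 =
        ∑ i ∈ Finset.univ.filter (fun i : Fin n => (i : ℕ) < k), (v - orderStat x i) := by
      refine Finset.sum_congr rfl fun i hi => max_eq_left (sub_nonneg.2 (orderStat_mono x ?_))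
      have := (Finset.mem_filter.1 hi).2
      rw [Fin.le_def]; simp only; omega
    have e2 : ∑ i ∈ Finset.univ.filter (fun i : Fin n => ¬ (i : ℕ) < k),
        max (v - orderStat x i) 0 = 0 := by
      refine Finset.sum_eq_zero fun i hi => max_eq_right (sub_nonpos.2 (orderStat_mono x ?_))
      have := (Finset.mem_filter.1 hi).2
      rw [Fin.le_def]; simp only; omega
    rw [e1, e2, Finset.sum_sub_distrib]
    ring
  -- `countLE x t` is a subgradient at `t` of the convex function `t ↦ ∑ (t - x i)⁺`.
  have hsub : ∑ i, max (t - x i) 0 + (v - t) * countLE x t ≤ ∑ i, max (v - x i) 0 := by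
    rw [countLE, Finset.mul_sum, ← Finset.sum_add_distrib]
    refine Finset.sum_le_sum fun i _ => ?_
    by_cases hi : x i ≤ t
    · rw [indicator_of_mem (by exact hi), max_eq_left (by linarith)]
      simp only [Pi.one_apply, mul_one]
      exact le_max_of_le_left (by linarith)
    · rw [indicator_of_notMem (by exact hi), max_eq_right (by linarith)]
      simp
  rw [partialSumGap, hS]
  calc k * v - ∑ i, max (v - x i) 0 - (k * t - ∑ i, max (t - x i) 0)
      ≤ (v - t) * (k - countLE x t) := by linarith
    _ ≤ |v - t| * |k - countLE x t| := by rw [← abs_mul]; exact le_abs_self _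
    _ ≤ δ * |k - countLE x t| := by
        gcongr
        rw [abs_le]; constructor <;> linarith

lemma sampleQCMean_eq (x : Fin n → ℝ) {a b : ℝ} (hab : a ≤ b) :
    sampleQCMean x a b = 1 / ((⌊n * b⌋₊ : ℝ) - (⌊n * a⌋₊ : ℝ)) *
      (partialSum x ⌊n * b⌋₊ - partialSum x ⌊n * a⌋₊) := by
  have hk : ⌊n * a⌋₊ ≤ ⌊n * b⌋₊ := Nat.floor_mono (by gcongr)
  rw [sampleQCMean]
  congr 1
  rw [partialSum, partialSum, eq_sub_iff_add_eq, ← Finset.sum_union]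
  · refine Finset.sum_congr ?_ fun _ _ => rfl
    ext i
    simp only [Finset.mem_union, Finset.mem_filter, Finset.mem_univ, true_and]
    omega
  · rw [Finset.disjoint_filter]
    intro i _ h1 h2
    omega

lemma measurable_orderStat (i : Fin n) : Measurable fun x : Fin n → ℝ => orderStat x i := by
  refine measurable_of_Iic fun t => ?_
  have : (fun x : Fin n → ℝ => orderStat x i) ⁻¹' Iic t =
      {x | ((i : ℕ) : ℝ) + 1 ≤ countLE x t} := by
    ext x; exact orderStat_le_iff x i t
  rw [this]
  refine measurableSet_le measurable_const ?_
  unfold countLE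
  refine Finset.measurable_sum _ fun j _ => ?_
  exact (measurable_one.indicator measurableSet_Iic).comp (measurable_pi_apply j)

lemma measurable_sampleQCMean (a b : ℝ) :
    Measurable fun x : Fin n → ℝ => sampleQCMean x a b := by
  unfold sampleQCMean
  exact (Finset.measurable_sum _ fun j _ => measurable_orderStat j).const_mul _

end OrderStatistics

/-! ### Quantiles and conditional means for atomless laws with support `[0, ∞)`. -/

section Quantile

/-- A law on `[0, ∞)` without atoms whose support is all of `[0, ∞)`. -/
structure IsFullNonneg (ν : Measure ℝ) : Prop where
  continuous : Continuous (cdf ν)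
  zero : cdf ν 0 = 0
  strictMonoOn : StrictMonoOn (cdf ν) (Ici 0)

variable {ν : Measure ℝ}

lemma IsFullNonneg.cdf_of_nonpos (h : IsFullNonneg ν) {x : ℝ} (hx : x ≤ 0) : cdf ν x = 0 :=
  le_antisymm ((monotone_cdf ν hx).trans_eq h.zero) (cdf_nonneg ν x)

lemma IsFullNonneg.exists_cdf_eq (h : IsFullNonneg ν) {p : ℝ} (hp : 0 ≤ p) (hp1 : p < 1) :
    ∃ q, 0 ≤ q ∧ cdf ν q = p := by
  obtain ⟨M, hM, hM0⟩ := (((tendsto_cdf_atTop ν).eventually_const_lt hp1).and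
    (eventually_ge_atTop 0)).exists
  obtain ⟨q, hq, hqp⟩ := intermediate_value_Icc hM0 h.continuous.continuousOn
    (show p ∈ Icc (cdf ν 0) (cdf ν M) from ⟨by rwa [h.zero], hM.le⟩)
  exact ⟨q, hq.1, hqp⟩

lemma IsFullNonneg.lt_cdf_add (h : IsFullNonneg ν) {q δ : ℝ} (hq : 0 ≤ q) (hδ : 0 < δ) :
    cdf ν q < cdf ν (q + δ) :=
  h.strictMonoOn hq (by simp only [mem_Ici]; linarith) (by linarith)

lemma IsFullNonneg.cdf_sub_lt (h : IsFullNonneg ν) {q δ : ℝ} (hq : 0 < q) (hδ : 0 < δ) :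
    cdf ν (q - δ) < cdf ν q := by
  rcases le_or_gt (q - δ) 0 with h1 | h1
  · rw [h.cdf_of_nonpos h1, ← h.zero]
    exact h.strictMonoOn self_mem_Ici hq.le hq
  · exact h.strictMonoOn h1.le hq.le (by linarith)

lemma IsFullNonneg.pos_of_cdf_pos (h : IsFullNonneg ν) {q : ℝ} (hq : 0 < cdf ν q) : 0 < q := by
  by_contra! hcon
  rw [h.cdf_of_nonpos hcon] at hq
  exact hq.false

lemma IsFullNonneg.quantile_eq (h : IsFullNonneg ν) {q : ℝ} (hq : 0 < cdf ν q) :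
    quantile ν (cdf ν q) = q := by
  have hq0 := h.pos_of_cdf_pos hq
  have : {x : ℝ | cdf ν q ≤ cdf ν x} = Ici q := by
    ext x
    simp only [mem_ofPred_eq, mem_Ici]
    refine ⟨fun hx => ?_, fun hx => monotone_cdf ν hx⟩
    by_contra! hlt
    have := h.cdf_sub_lt hq0 (sub_pos.2 hlt)
    rw [sub_sub_cancel] at this
    linarith
  rw [quantile, this]
  exact IsLeast.csInf_eq ⟨mem_image_of_mem _ self_mem_Ici, by
    rintro _ ⟨x, hx, rfl⟩
    exact EReal.coe_le_coe_iff.2 hx⟩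

lemma quantile_zero : quantile ν 0 = ⊥ := by
  have : {x : ℝ | 0 ≤ cdf ν x} = univ := eq_univ_of_forall fun x => cdf_nonneg ν x
  rw [quantile, this, sInf_eq_bot]
  intro b hb
  induction b with
  | bot => exact absurd hb (lt_irrefl _)
  | coe r => exact ⟨(r - 1 : ℝ), mem_image_of_mem _ (mem_univ _),
      EReal.coe_lt_coe_iff.2 (by linarith)⟩
  | top => exact ⟨(0 : ℝ), mem_image_of_mem _ (mem_univ _), EReal.coe_lt_top 0⟩

variable [IsProbabilityMeasure ν]

lemma IsFullNonneg.measureReal_Ioc (_ : IsFullNonneg ν) {x y : ℝ} (hxy : x ≤ y) :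
    ν.real (Ioc x y) = cdf ν y - cdf ν x := by
  rw [cdf_eq_real, cdf_eq_real, ← Iic_sdiff_Iic,
    measureReal_sdiff (Iic_subset_Iic.2 hxy) measurableSet_Iic]

lemma IsFullNonneg.measure_singleton (h : IsFullNonneg ν) (x : ℝ) : ν {x} = 0 := by
  rw [← measure_cdf ν, StieltjesFunction.measure_singleton, ENNReal.ofReal_eq_zero]
  rw [(h.continuous.continuousAt.continuousWithinAt).leftLim_eq]
  simp

lemma IsFullNonneg.nullSingletonClass (h : IsFullNonneg ν) : NullSingletonClass ν :=
  ⟨fun x => h.measure_singleton x⟩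

lemma IsFullNonneg.ae_pos (h : IsFullNonneg ν) : ∀ᵐ x ∂ν, 0 < x := by
  rw [ae_iff]
  have : {x : ℝ | ¬ 0 < x} = Iic 0 := by ext; simp
  rw [this, ← measureReal_eq_zero_iff, ← cdf_eq_real, h.zero]

/-- Endpoints are null. For `p = 0` the lower quantile is `-∞`, but the extra half-line is null too,
so this case needs no separate treatment later. -/
lemma IsFullNonneg.quantileSet_ae_eq (h : IsFullNonneg ν) {p q : ℝ} (hp : 0 ≤ p) (hpq : p < q) :
    quantileSet ν (cdf ν p) (cdf ν q) =ᵐ[ν] Ioc p q := by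
  have hna := h.nullSingletonClass
  have hq : 0 < cdf ν q := by
    rw [← h.zero]; exact h.strictMonoOn self_mem_Ici (hp.trans hpq.le) (hp.trans_lt hpq)
  rcases hp.eq_or_lt with rfl | hp
  · have : quantileSet ν (cdf ν 0) (cdf ν q) = Iic q := by
      ext x
      simp [quantileSet, h.zero, quantile_zero, h.quantile_eq hq]
    rw [this]
    filter_upwards [h.ae_pos] with x hx
    refine propext (?_ : x ∈ Iic q ↔ x ∈ Ioc 0 q)
    simp [hx]
  · have hp' : 0 < cdf ν p := by
      rw [← h.zero]; exact h.strictMonoOn self_mem_Ici hp.le hp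
    have : quantileSet ν (cdf ν p) (cdf ν q) = Icc p q := by
      ext x
      simp [quantileSet, h.quantile_eq hp', h.quantile_eq hq]
    rw [this]
    exact Ioc_ae_eq_Icc.symm

lemma IsFullNonneg.qcMean_eq (h : IsFullNonneg ν) {p q : ℝ} (hp : 0 ≤ p) (hpq : p < q) :
    qcMean ν (cdf ν p) (cdf ν q) = (cdf ν q - cdf ν p)⁻¹ * ∫ x in Ioc p q, x ∂ν := by
  have hae := h.quantileSet_ae_eq hp hpq
  rw [qcMean, ProbabilityTheory.cond, Measure.restrict_congr_set hae, measure_congr hae,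
    integral_smul_measure, smul_eq_mul, ENNReal.toReal_inv, ← measureReal_def,
    h.measureReal_Ioc hpq.le]

lemma IsFullNonneg.qcMean_pos (h : IsFullNonneg ν) {p q : ℝ} (hp : 0 ≤ p) (hpq : p < q) :
    0 < qcMean ν (cdf ν p) (cdf ν q) := by
  have hlt := h.strictMonoOn hp (hp.trans hpq.le) hpq
  rw [h.qcMean_eq hp hpq]
  refine mul_pos (inv_pos.2 (sub_pos.2 hlt)) ?_
  rw [setIntegral_pos_iff_support_of_nonneg_ae]
  · have : Function.support (fun x : ℝ => x) ∩ Ioc p q = Ioc p q :=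
      inter_eq_right.2 fun x hx => (hp.trans_lt hx.1).ne'
    rw [this]
    refine ((ENNReal.toReal_pos_iff).1 ?_).1
    rw [← measureReal_def, h.measureReal_Ioc hpq.le]
    exact sub_pos.2 hlt
  · filter_upwards [ae_restrict_mem measurableSet_Ioc] with x hx
    exact hp.trans hx.1.le
  · exact continuous_id.continuousOn.integrableOn_Icc.mono_set Ioc_subset_Icc_self

/-! ### Ramp functions. -/

/-- The function `x ↦ (q - x)⁺ - (p - x)⁺`. -/
def ramp (p q x : ℝ) : ℝ := max (q - x) 0 - max (p - x) 0

lemma continuous_ramp (p q : ℝ) : Continuous (ramp p q) := by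
  unfold ramp; fun_prop

lemma ramp_of_le {p q x : ℝ} (hpq : p ≤ q) (hx : x ≤ p) : ramp p q x = q - p := by
  rw [ramp, max_eq_left (by linarith), max_eq_left (by linarith)]; ring

lemma ramp_of_mem {p q x : ℝ} (hx : x ∈ Icc p q) : ramp p q x = q - x := by
  rw [ramp, max_eq_left (by linarith [hx.2]), max_eq_right (by linarith [hx.1])]; ring

lemma ramp_of_ge {p q x : ℝ} (hpq : p ≤ q) (hx : q ≤ x) : ramp p q x = 0 := by
  rw [ramp, max_eq_right (by linarith), max_eq_right (by linarith)]; ring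

lemma abs_ramp_le {p q : ℝ} (hpq : p ≤ q) (x : ℝ) : |ramp p q x| ≤ q - p := by
  rcases le_total x p with hx | hx
  · rw [ramp_of_le hpq hx, abs_of_nonneg (by linarith)]
  rcases le_total x q with hx' | hx'
  · rw [ramp_of_mem ⟨hx, hx'⟩, abs_of_nonneg (by linarith)]; linarith
  · rw [ramp_of_ge hpq hx', abs_zero]; linarith

/-- This identifies the centring of the sum of ramps with the conditional mean; it follows from
writing the ramp as `q 1_{x ≤ q} - p 1_{x ≤ p} - x 1_{p < x ≤ q}`. -/
lemma IsFullNonneg.integral_ramp (h : IsFullNonneg ν) {p q : ℝ} (hp : 0 ≤ p) (hpq : p < q) :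
    ∫ x, ramp p q x ∂ν = q * cdf ν q - p * cdf ν p -
      (cdf ν q - cdf ν p) * qcMean ν (cdf ν p) (cdf ν q) := by
  have hlt := h.strictMonoOn hp (hp.trans hpq.le) hpq
  have e : ramp p q = fun x => (Iic q).indicator (fun _ => q) x -
      (Iic p).indicator (fun _ => p) x - (Ioc p q).indicator (fun x => x) x := by
    ext x
    rcases le_or_gt x p with hx | hx
    · rw [ramp_of_le hpq.le hx, indicator_of_mem (by exact hx.trans hpq.le),
        indicator_of_mem (by exact hx), indicator_of_notMem (fun hx' => hx'.1.not_ge hx)]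
      ring
    rcases le_or_gt x q with hx' | hx'
    · rw [ramp_of_mem ⟨hx.le, hx'⟩, indicator_of_mem (by exact hx'),
        indicator_of_notMem (by simpa using hx), indicator_of_mem (by exact ⟨hx, hx'⟩)]
      ring
    · rw [ramp_of_ge hpq.le hx'.le, indicator_of_notMem (by simpa using hx'),
        indicator_of_notMem (by simpa using hx),
        indicator_of_notMem (fun h' => h'.2.not_gt hx')]
      ring
  have i1 : Integrable ((Iic q).indicator (fun _ : ℝ => q)) ν :=
    (integrable_const q).indicator measurableSet_Iic
  have i2 : Integrable ((Iic p).indicator (fun _ : ℝ => p)) ν :=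
    (integrable_const p).indicator measurableSet_Iic
  have i3 : Integrable ((Ioc p q).indicator (fun x : ℝ => x)) ν := by
    rw [integrable_indicator_iff measurableSet_Ioc]
    exact continuous_id.continuousOn.integrableOn_Icc.mono_set Ioc_subset_Icc_self
  have e1 : ∫ x, ramp p q x ∂ν = (∫ x, (Iic q).indicator (fun _ => q) x ∂ν) -
      (∫ x, (Iic p).indicator (fun _ => p) x ∂ν) -
      ∫ x, (Ioc p q).indicator (fun x => x) x ∂ν := by
    rw [e, ← integral_sub i1 i2]
    exact integral_sub (i1.sub i2) i3
  rw [e1, integral_indicator measurableSet_Iic,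
    integral_indicator measurableSet_Iic, integral_indicator measurableSet_Ioc,
    setIntegral_const, setIntegral_const, ← cdf_eq_real, ← cdf_eq_real, h.qcMean_eq hp hpq,
    mul_inv_cancel_left₀ (sub_pos.2 hlt).ne', smul_eq_mul, smul_eq_mul]
  ring

lemma IsFullNonneg.eqOn_of_ae_eq (h : IsFullNonneg ν) {f g : ℝ → ℝ} (hf : Continuous f)
    (hg : Continuous g) (hfg : f =ᵐ[ν] g) : EqOn f g (Ici 0) := by
  have key : EqOn f g (Ioi 0) := by
    intro x hx
    by_contra hne
    have hopen : IsOpen ({y | f y ≠ g y} ∩ Ioi 0) := (isOpen_ne_fun hf hg).inter isOpen_Ioi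
    obtain ⟨δ, hδ, hball⟩ := Metric.isOpen_iff.1 hopen x ⟨hne, hx⟩
    have hsub : Ioc x (x + δ / 2) ⊆ {y | f y ≠ g y} := fun y hy =>
      (hball (by rw [Metric.mem_ball, Real.dist_eq, abs_lt]; constructor <;>
        linarith [hy.1, hy.2])).1
    have h0 : ν (Ioc x (x + δ / 2)) = 0 := measure_mono_null hsub (ae_iff.1 hfg)
    rw [← measureReal_eq_zero_iff, h.measureReal_Ioc (by linarith)] at h0
    linarith [h.lt_cdf_add (le_of_lt hx) (half_pos hδ)]
  have := key.closure hf hg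
  rwa [closure_Ioi] at this

/-- A ramp is flat up to `p`, strictly decreasing on `[p, q]` and zero after `q`. Only inequalities
are stated; exchanging the two ramps gives the reverse ones. -/
lemma ramp_linear_injective {p₁ q₁ p₂ q₂ k₁ k₂ : ℝ} (hp₁ : 0 ≤ p₁) (hpq₁ : p₁ < q₁)
    (hp₂ : 0 ≤ p₂) (hpq₂ : p₂ < q₂) (hk₁ : 0 < k₁) (hk₂ : 0 < k₂)
    (h : EqOn (fun x => k₁ * ramp p₁ q₁ x) (fun x => k₂ * ramp p₂ q₂ x) (Ici 0)) :
    p₁ ≤ p₂ ∧ q₁ ≤ q₂ := by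
  constructor
  · by_contra! hlt
    have e0 := h (show (0 : ℝ) ∈ Ici 0 from self_mem_Ici)
    -- Between `0` and this point the first ramp keeps its top value while the second has already
    -- started to fall.
    have e1 := h (show min p₁ q₂ ∈ Ici 0 from le_min hp₁ (hp₂.trans hpq₂.le))
    simp only at e0 e1
    rw [ramp_of_le hpq₁.le hp₁, ramp_of_le hpq₂.le hp₂] at e0
    rw [ramp_of_le hpq₁.le (min_le_left _ _),
      ramp_of_mem ⟨le_min hlt.le hpq₂.le, min_le_right _ _⟩, e0] at e1
    have := mul_left_cancel₀ hk₂.ne' e1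
    have : p₂ < min p₁ q₂ := lt_min hlt hpq₂
    linarith
  · by_contra! hlt
    -- Here the second ramp has reached zero and the first is still positive.
    have e1 := h (show max p₁ q₂ ∈ Ici 0 from hp₁.trans (le_max_left _ _))
    simp only at e1
    rw [ramp_of_mem ⟨le_max_left _ _, max_le hpq₁.le hlt.le⟩,
      ramp_of_ge hpq₂.le (le_max_right _ _), mul_zero] at e1
    have : max p₁ q₂ < q₁ := max_lt hpq₁ hlt
    nlinarith

end Quantile

/-! ### The Lévy law: full support and scaling. -/

section Levy

lemma stdNormalCDF_strictMono : StrictMono stdNormalCDF := by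
  intro x y hxy
  have h : (gaussianReal 0 1) (Ioc x y) ≠ 0 := by
    intro h0
    have := gaussianReal_absolutelyContinuous' 0 (one_ne_zero : (1 : ℝ≥0) ≠ 0) h0
    rw [Real.volume_Ioc, ENNReal.ofReal_eq_zero] at this
    linarith
  have h1 : 0 < (gaussianReal 0 1).real (Ioc x y) :=
    ENNReal.toReal_pos h (measure_ne_top _ _)
  rw [← Iic_sdiff_Iic, measureReal_sdiff (Iic_subset_Iic.2 hxy.le) measurableSet_Iic] at h1
  rw [stdNormalCDF, stdNormalCDF, cdf_eq_real, cdf_eq_real]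
  linarith

lemma isFullNonneg_levyMeasure (c : ℝ) (hc : 0 < c) : IsFullNonneg (levyMeasure c hc) where
  continuous := by
    have e : ⇑(cdf (levyMeasure c hc)) = levyCDF c := funext (cdf_levyMeasure c hc)
    rw [e, continuous_iff_continuousAt]
    intro x
    rcases le_or_gt x 0 with hx | hx
    · refine continuousAt_iff_continuous_left_right.2 ⟨?_, levyCDF_rightCts hc x⟩
      refine (continuousWithinAt_const (b := (0 : ℝ))).congr
        (fun y hy => levyCDF_of_nonpos c (le_trans hy hx)) (levyCDF_of_nonpos c hx)
    · have h : ContinuousAt (fun y : ℝ => 2 - 2 * stdNormalCDF (√(c / y))) x := by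
        have h1 : ContinuousAt (fun y : ℝ => √(c / y)) x :=
          (continuousAt_const.div continuousAt_id hx.ne').sqrt
        exact continuousAt_const.sub (continuousAt_const.mul
          (continuous_stdNormalCDF.continuousAt.comp h1))
      refine h.congr ?_
      filter_upwards [Ioi_mem_nhds hx] with y hy
      exact (levyCDF_of_pos c hy).symm
  zero := by rw [cdf_levyMeasure, levyCDF_of_nonpos c le_rfl]
  strictMonoOn := by
    have key : ∀ x y : ℝ, 0 < x → x < y → levyCDF c x < levyCDF c y := by
      intro x y hx hxy
      rw [levyCDF_of_pos c hx, levyCDF_of_pos c (hx.trans hxy)]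
      have : √(c / y) < √(c / x) :=
        Real.sqrt_lt_sqrt (div_nonneg hc.le (hx.trans hxy).le) (by gcongr)
      linarith [stdNormalCDF_strictMono this]
    intro x hx y _ hxy
    rw [cdf_levyMeasure, cdf_levyMeasure]
    rcases (show (0 : ℝ) ≤ x from hx).eq_or_lt with rfl | hx
    -- At the left endpoint `0`, where the formula with `√(c / x)` is not available, strictness
    -- comes from the pair `y / 2 < y`.
    · have h1 := key (y / 2) y (by linarith) (by linarith)
      exact (levyCDF_mono hc (by linarith : (0 : ℝ) ≤ y / 2)).trans_lt h1
    · exact key x y hx hxy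

lemma map_inv_mul_levyMeasure (c : ℝ) (hc : 0 < c) :
    (levyMeasure c hc).map (fun x => c⁻¹ * x) = levyMeasure 1 one_pos := by
  have hm : Measurable fun x : ℝ => c⁻¹ * x := measurable_const_mul _
  have : IsProbabilityMeasure ((levyMeasure c hc).map (fun x => c⁻¹ * x)) :=
    Measure.isProbabilityMeasure_map hm.aemeasurable
  refine Measure.eq_of_cdf _ _ (StieltjesFunction.ext fun x => ?_)
  rw [cdf_levyMeasure, cdf_eq_real, map_measureReal_apply hm measurableSet_Iic]
  have : (fun x : ℝ => c⁻¹ * x) ⁻¹' Iic x = Iic (c * x) := by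
    ext y
    simp only [mem_preimage, mem_Iic]
    rw [inv_mul_le_iff₀ hc]
  rw [this, ← cdf_eq_real, cdf_levyMeasure, levyCDF, levyCDF]
  have e : c / (c * x) = 1 / x := by
    rcases eq_or_ne x 0 with rfl | hx
    · simp
    · field_simp
  rw [e]
  congr 1
  rw [mul_nonpos_iff_pos_imp_nonpos]
  simp [hc, hc.le]

end Levy

/-! ### Asymptotic linearity of sample quantile conditional means. -/

section Asymptotics

lemma aemeasurable_sampleQCMean {Ω : Type*} {mΩ : MeasurableSpace Ω} {P : Measure Ω}
    {ν : Measure ℝ} {X : ℕ → Ω → ℝ} (hX : ∀ i, HasLaw (X i) ν P) (a b : ℝ) (n : ℕ) :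
    AEMeasurable (fun ω => sampleQCMean (fun i : Fin n => X i ω) a b) P :=
  (measurable_sampleQCMean a b).comp_aemeasurable
    (aemeasurable_pi_lambda _ fun i => (hX i).aemeasurable)

variable {Ω : Type*} {mΩ : MeasurableSpace Ω} {P : Measure Ω} [IsProbabilityMeasure P]
  {ν : Measure ℝ} [IsProbabilityMeasure ν] {X : ℕ → Ω → ℝ}

lemma sqrt_mul_normSum (ν : Measure ℝ) (X : ℕ → Ω → ℝ) (g : ℝ → ℝ) (n : ℕ) (ω : Ω) :
    √(n : ℝ) * normSum ν X g n ω = ∑ i ∈ Finset.range n, g (X i ω) - n * ∫ x, g x ∂ν := by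
  rcases Nat.eq_zero_or_pos n with rfl | hn
  · simp
  · have : √(n : ℝ) ≠ 0 := (Real.sqrt_pos.2 (by exact_mod_cast hn)).ne'
    rw [normSum, mul_inv_cancel_left₀ this]

lemma countLE_eq (X : ℕ → Ω → ℝ) (t : ℝ) (n : ℕ) (ω : Ω) :
    countLE (fun i : Fin n => X i ω) t =
      n * cdf ν t + √(n : ℝ) * normSum ν X ((Iic t).indicator 1) n ω := by
  rw [sqrt_mul_normSum, countLE, Finset.sum_range, integral_indicator_one measurableSet_Iic,
    ← cdf_eq_real]
  ring

lemma abs_indicator_one_le (t x : ℝ) : |(Iic t).indicator (1 : ℝ → ℝ) x| ≤ 1 := by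
  by_cases h : x ≤ t <;> simp [h]

lemma measurable_indicator_Iic (t : ℝ) : Measurable ((Iic t).indicator (1 : ℝ → ℝ)) :=
  measurable_one.indicator measurableSet_Iic

lemma tendstoInMeasure_partialSumGap (h : IsFullNonneg ν) (hX : ∀ i, HasLaw (X i) ν P)
    (hind : iIndepFun X P) {q : ℝ} (hq : 0 ≤ q) :
    TendstoInMeasure P (fun (n : ℕ) ω => (√(n : ℝ))⁻¹ *
      partialSumGap (fun i : Fin n => X i ω) ⌊n * cdf ν q⌋₊ q) atTop 0 := by
  rcases hq.eq_or_lt with rfl | hq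
  -- For `q = 0` the gap vanishes almost surely: `k = 0` and all observations are positive.
  · have hpos : ∀ᵐ ω ∂P, ∀ i, 0 < X i ω := by
      rw [ae_all_iff]
      intro i
      have := h.ae_pos
      rw [← (hX i).map_eq] at this
      exact ae_of_ae_map (hX i).aemeasurable this
    refine TendstoInMeasure.congr_left (f := fun _ _ => (0 : ℝ)) (fun n => ?_)
      (tendstoInMeasure_zero_of_tendsto tendsto_const_nhds)
    filter_upwards [hpos] with ω hω
    have : ∀ i : Fin n, max (0 - X i ω) 0 = 0 := fun i => max_eq_right (by linarith [hω i])
    simp only [partialSumGap, Finset.sum_congr rfl fun i _ => this i]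
    simp [partialSum, h.zero]
  set p := cdf ν q with hp
  have hp0 : 0 < p := by rw [hp, ← h.zero]; exact h.strictMonoOn self_mem_Ici hq.le hq
  have hp1 : p ≤ 1 := cdf_le_one ν q
  refine tendstoInMeasure_zero_of_abs_le (stochBdd_normSum hX hind (measurable_indicator_Iic q)
    (abs_indicator_one_le q)) fun δ hδ => ?_
  have hd1 : 0 < cdf ν (q + δ) - p := sub_pos.2 (h.lt_cdf_add hq.le hδ)
  -- Half of the margin below `p` absorbs the random fluctuation, the other half the loss of at most
  -- `1` in `⌊n p⌋`. Above `p` rounding goes the right way, so `d1` is not halved.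
  have hd2 : 0 < (p - cdf ν (q - δ)) / 2 := half_pos (sub_pos.2 (h.cdf_sub_lt hq hδ))
  set d1 := cdf ν (q + δ) - p with hd1'
  set d2 := (p - cdf ν (q - δ)) / 2 with hd2'
  refine ⟨fun n => {ω | √n * d1 ≤ |normSum ν X ((Iic (q + δ)).indicator 1) n ω|} ∪
    {ω | √n * d2 ≤ |normSum ν X ((Iic (q - δ)).indicator 1) n ω|}, ?_, ?_⟩
  · have h1 := (tendsto_meas_normSum_ge hX hind (measurable_indicator_Iic (q + δ))
      (abs_indicator_one_le _) hd1).add (tendsto_meas_normSum_ge hX hind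
      (measurable_indicator_Iic (q - δ)) (abs_indicator_one_le _) hd2)
    rw [add_zero] at h1
    exact tendsto_of_tendsto_of_tendsto_of_le_of_le tendsto_const_nhds h1 (fun _ => zero_le)
      fun n => measure_union_le _ _
  have hN : ∀ c : ℝ, 0 < c → ∀ᶠ n : ℕ in atTop, 1 ≤ (n : ℝ) * c := fun c hc =>
    (tendsto_natCast_atTop_atTop.atTop_mul_const hc).eventually_ge_atTop 1
  filter_upwards [hN 1 one_pos, hN p hp0, hN d2 hd2] with n hn1 hnp hnd ω hω
  rw [mul_one] at hn1
  simp only [mem_union, mem_ofPred_eq, not_or, not_le] at hω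
  have hs : 1 ≤ √(n : ℝ) := Real.one_le_sqrt.2 hn1
  have hs0 : 0 < √(n : ℝ) := by linarith
  have hss : √(n : ℝ) * √(n : ℝ) = n := Real.mul_self_sqrt (by linarith)
  set k := ⌊(n : ℝ) * p⌋₊ with hk
  have hk1 : (k : ℝ) ≤ n * p := Nat.floor_le (by positivity)
  have hk2 : (n : ℝ) * p < k + 1 := Nat.lt_floor_add_one _
  have hk0 : 0 < k := Nat.floor_pos.2 hnp
  have hkn : k ≤ n := by
    have : (k : ℝ) ≤ n := hk1.trans (mul_le_of_le_one_right (by linarith) hp1)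
    exact_mod_cast this
  have hlo : countLE (fun i : Fin n => X i ω) (q - δ) < k := by
    rw [countLE_eq (ν := ν)]
    have := mul_lt_mul_of_pos_left ((le_abs_self _).trans_lt hω.2) hs0
    rw [← mul_assoc, hss] at this
    have e : (n : ℝ) * cdf ν (q - δ) = n * p - 2 * (n * d2) := by rw [hd2']; ring
    linarith
  have hhi : k ≤ countLE (fun i : Fin n => X i ω) (q + δ) := by
    rw [countLE_eq (ν := ν)]
    have := mul_lt_mul_of_pos_left ((neg_le_abs _).trans_lt hω.1) hs0
    rw [← mul_assoc, hss] at this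
    have e : (n : ℝ) * cdf ν (q + δ) = n * p + n * d1 := by rw [hd1']; ring
    linarith
  have hgap := partialSumGap_le _ hk0 hkn hlo hhi
  rw [countLE_eq (ν := ν), ← hp] at hgap
  set U := normSum ν X ((Iic q).indicator 1) n ω
  have h3 : |k - (n * p + √(n : ℝ) * U)| ≤ 1 + √(n : ℝ) * |U| := by
    have e : (k : ℝ) - (n * p + √(n : ℝ) * U) = (k - n * p) - √(n : ℝ) * U := by ring
    rw [e]
    refine (abs_sub _ _).trans (add_le_add ?_ ?_)
    · rw [abs_le]; constructor <;> linarith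
    · rw [abs_mul, abs_of_pos hs0]
  rw [abs_mul, abs_of_pos (inv_pos.2 hs0), inv_mul_le_iff₀ hs0]
  calc _ ≤ δ * (1 + √(n : ℝ) * |U|) := hgap.trans (by gcongr)
    _ ≤ δ * (√(n : ℝ) + √(n : ℝ) * |U|) := by gcongr
    _ = √(n : ℝ) * (δ * (1 + |U|)) := by ring

lemma tendsto_inv_sqrt_natCast : Tendsto (fun n : ℕ => (√(n : ℝ))⁻¹) atTop (𝓝 0) :=
  tendsto_inv_atTop_zero.comp (Real.tendsto_sqrt_atTop.comp tendsto_natCast_atTop_atTop)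

lemma tendsto_div_floor_sub_floor {a b : ℝ} (ha : 0 ≤ a) (hab : a < b) :
    Tendsto (fun n : ℕ => (n : ℝ) / ((⌊n * b⌋₊ : ℝ) - ⌊n * a⌋₊)) atTop (𝓝 (b - a)⁻¹) := by
  have key : ∀ c : ℝ, 0 ≤ c → Tendsto (fun n : ℕ => (⌊n * c⌋₊ : ℝ) / n) atTop (𝓝 c) := by
    intro c hc
    have := (tendsto_nat_floor_mul_div_atTop hc).comp (tendsto_natCast_atTop_atTop (R := ℝ))
    refine this.congr fun n => ?_
    simp [mul_comm]
  have h := ((key b (ha.trans hab.le)).sub (key a ha)).inv₀ (sub_pos.2 hab).ne'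
  refine h.congr fun n => ?_
  rw [← sub_div, inv_div]

lemma tendstoInMeasure_sampleQCMean (h : IsFullNonneg ν) (hX : ∀ i, HasLaw (X i) ν P)
    (hind : iIndepFun X P) {p q : ℝ} (hp : 0 ≤ p) (hpq : p < q) :
    TendstoInMeasure P (fun (n : ℕ) ω => √(n : ℝ) *
        (sampleQCMean (fun i : Fin n => X i ω) (cdf ν p) (cdf ν q) -
          qcMean ν (cdf ν p) (cdf ν q)) +
        (cdf ν q - cdf ν p)⁻¹ * normSum ν X (ramp p q) n ω) atTop 0 := by
  have hlt := h.strictMonoOn hp (hp.trans hpq.le) hpq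
  have hint := h.integral_ramp hp hpq
  set μ := qcMean ν (cdf ν p) (cdf ν q)
  have ha : 0 ≤ cdf ν p := cdf_nonneg ν p
  set a := cdf ν p with ha'
  set b := cdf ν q with hb'
  have hba : 0 < b - a := sub_pos.2 hlt
  -- The deterministic error from rounding `n a` and `n b` down; it is of order `n^{-1/2}`.
  set e : ℕ → ℝ := fun n => (√(n : ℝ))⁻¹ *
    ((⌊n * b⌋₊ - n * b) * (q - μ) - (⌊n * a⌋₊ - n * a) * (p - μ)) with he
  have he0 : Tendsto e atTop (𝓝 0) := by
    have hfl : ∀ (n : ℕ) (c : ℝ), 0 ≤ c → |(⌊n * c⌋₊ : ℝ) - n * c| ≤ 1 := fun n c hc => by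
      have h1 := Nat.floor_le (mul_nonneg (Nat.cast_nonneg n) hc)
      have h2 := Nat.lt_floor_add_one ((n : ℝ) * c)
      rw [abs_le]; constructor <;> linarith
    have h1 := tendsto_inv_sqrt_natCast.mul_const (|q - μ| + |p - μ|)
    rw [zero_mul] at h1
    refine squeeze_zero_norm (fun n => ?_) h1
    rw [he, norm_mul, Real.norm_of_nonneg (inv_nonneg.2 (Real.sqrt_nonneg _)), Real.norm_eq_abs]
    gcongr
    refine (abs_sub _ _).trans (add_le_add ?_ ?_) <;> rw [abs_mul]
    · exact mul_le_of_le_one_left (abs_nonneg _) (hfl n b (ha.trans hlt.le))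
    · exact mul_le_of_le_one_left (abs_nonneg _) (hfl n a ha)
  set G : ℕ → Ω → ℝ := fun n ω =>
    (√(n : ℝ))⁻¹ * partialSumGap (fun i : Fin n => X i ω) ⌊n * b⌋₊ q +
      (-1) * ((√(n : ℝ))⁻¹ * partialSumGap (fun i : Fin n => X i ω) ⌊n * a⌋₊ p) + e n with hG
  have hG0 : TendstoInMeasure P G atTop 0 :=
    TendstoInMeasure.add_zero (TendstoInMeasure.add_zero
      (tendstoInMeasure_partialSumGap h hX hind (hp.trans hpq.le))
      (TendstoInMeasure.const_mul_zero (tendstoInMeasure_partialSumGap h hX hind hp) (-1)))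
      (tendstoInMeasure_zero_of_tendsto he0)
  have hr := tendsto_div_floor_sub_floor ha hlt
  refine tendstoInMeasure_zero_of_abs_le (stochBdd_normSum hX hind
    (continuous_ramp p q).measurable (abs_ramp_le hpq.le)) fun δ hδ => ?_
  have hba' : 0 < (b - a)⁻¹ := inv_pos.2 hba
  -- Since `n / d` is eventually below `2 (b - a)⁻¹`, this threshold makes `|G n ω| · (n / d)` at
  -- most `δ`.
  refine ⟨fun n => {ω | δ / (2 * (b - a)⁻¹) ≤ |G n ω|},
    tendstoInMeasure_zero_iff.1 hG0 _ (by positivity), ?_⟩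
  filter_upwards [hr.eventually_lt_const (by linarith : (b - a)⁻¹ < 2 * (b - a)⁻¹),
    hr.eventually_const_lt hba', Metric.tendsto_nhds.1 hr δ hδ, eventually_gt_atTop 0]
    with n hr1 hr2 hr3 hn ω hω
  simp only [not_le] at hω
  rw [Real.dist_eq] at hr3
  have hn0 : (0 : ℝ) < n := by exact_mod_cast hn
  set d : ℝ := (⌊n * b⌋₊ : ℝ) - ⌊n * a⌋₊ with hd
  have hd0 : 0 < d := by
    by_contra! hcon
    exact hr2.not_ge (div_nonpos_of_nonneg_of_nonpos hn0.le hcon)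
  have hs0 : 0 < √(n : ℝ) := Real.sqrt_pos.2 hn0
  have hss : √(n : ℝ) * √(n : ℝ) = n := Real.mul_self_sqrt hn0.le
  have hU := sqrt_mul_normSum ν X (ramp p q) n ω
  rw [hint] at hU
  set U := normSum ν X (ramp p q) n ω
  -- An exact identity: the first term is small because `G` is, the second because `n / d` tends to
  -- `(b - a)⁻¹` while `U` is tight.
  have hid : √(n : ℝ) * (sampleQCMean (fun i : Fin n => X i ω) a b - μ) + (b - a)⁻¹ * U =
      G n ω * (n / d) - U * (n / d - (b - a)⁻¹) := by
    have hsum : ∑ i ∈ Finset.range n, ramp p q (X i ω) =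
        ∑ i : Fin n, max (q - X i ω) 0 - ∑ i : Fin n, max (p - X i ω) 0 := by
      rw [← Finset.sum_sub_distrib, Finset.sum_range]; rfl
    have hZ : partialSum (fun i : Fin n => X i ω) ⌊n * b⌋₊ -
        partialSum (fun i : Fin n => X i ω) ⌊n * a⌋₊ - d * μ = √(n : ℝ) * (G n ω - U) := by
      have e1 : √(n : ℝ) * (G n ω - U) =
          partialSumGap (fun i : Fin n => X i ω) ⌊n * b⌋₊ q -
          partialSumGap (fun i : Fin n => X i ω) ⌊n * a⌋₊ p +
          ((⌊n * b⌋₊ - n * b) * (q - μ) - (⌊n * a⌋₊ - n * a) * (p - μ)) - √(n : ℝ) * U := by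
        simp only [hG, he]
        field_simp
        ring
      rw [e1, hU, hsum, partialSumGap, partialSumGap, hd]
      ring
    have hM : sampleQCMean (fun i : Fin n => X i ω) a b - μ = √(n : ℝ) * (G n ω - U) / d := by
      rw [sampleQCMean_eq _ hlt.le, ← hd, ← hZ]
      field_simp
    rw [hM, ← mul_div_assoc, ← mul_assoc, hss]
    ring
  rw [hid]
  have h1 : |G n ω * (n / d)| ≤ δ := by
    rw [abs_mul, abs_of_pos (div_pos hn0 hd0)]
    calc |G n ω| * (n / d) ≤ δ / (2 * (b - a)⁻¹) * (2 * (b - a)⁻¹) := by gcongr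
      _ = δ := div_mul_cancel₀ _ (by positivity)
  have h2 : |U * (n / d - (b - a)⁻¹)| ≤ δ * |U| := by
    rw [abs_mul, mul_comm]
    gcongr
  linarith [abs_sub (G n ω * (n / d)) (U * (n / d - (b - a)⁻¹))]

/-! ### The influence function, positivity of its variance, and the limit law of the ratio. -/

/-- The linear combination of ramps that gives the asymptotically linear representation of a
difference of normalised sample quantile conditional means. -/
noncomputable def influence (ν : Measure ℝ) (p₁ q₁ p₂ q₂ x : ℝ) : ℝ :=
  ((cdf ν q₂ - cdf ν p₂) * qcMean ν (cdf ν p₂) (cdf ν q₂))⁻¹ * ramp p₂ q₂ x -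
    ((cdf ν q₁ - cdf ν p₁) * qcMean ν (cdf ν p₁) (cdf ν q₁))⁻¹ * ramp p₁ q₁ x

lemma continuous_influence (ν : Measure ℝ) (p₁ q₁ p₂ q₂ : ℝ) :
    Continuous (influence ν p₁ q₁ p₂ q₂) :=
  ((continuous_ramp p₂ q₂).const_mul _).sub ((continuous_ramp p₁ q₁).const_mul _)

lemma exists_abs_influence_le (ν : Measure ℝ) {p₁ q₁ p₂ q₂ : ℝ} (h₁ : p₁ ≤ q₁) (h₂ : p₂ ≤ q₂) :
    ∃ C, ∀ x, |influence ν p₁ q₁ p₂ q₂ x| ≤ C := by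
  refine ⟨|((cdf ν q₂ - cdf ν p₂) * qcMean ν (cdf ν p₂) (cdf ν q₂))⁻¹| * (q₂ - p₂) +
    |((cdf ν q₁ - cdf ν p₁) * qcMean ν (cdf ν p₁) (cdf ν q₁))⁻¹| * (q₁ - p₁),
    fun x => (abs_sub _ _).trans (add_le_add ?_ ?_)⟩ <;> rw [abs_mul] <;> gcongr
  · exact abs_ramp_le h₂ x
  · exact abs_ramp_le h₁ x

lemma variance_influence_pos (h : IsFullNonneg ν) {p₁ q₁ p₂ q₂ : ℝ} (hp₁ : 0 ≤ p₁)
    (hpq₁ : p₁ < q₁) (hp₂ : 0 ≤ p₂) (hpq₂ : p₂ < q₂) (hne : (p₁, q₁) ≠ (p₂, q₂)) :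
    0 < variance (influence ν p₁ q₁ p₂ q₂) ν := by
  refine (variance_nonneg _ _).lt_of_ne' fun h0 => hne ?_
  obtain ⟨C, hC⟩ := exists_abs_influence_le ν hpq₁.le hpq₂.le
  have hc := continuous_influence ν p₁ q₁ p₂ q₂
  have hae := ae_eq_integral_of_variance_eq_zero (memLp_of_abs_le hc.measurable hC 2) h0
  have hEq := h.eqOn_of_ae_eq hc (continuous_const (y := ∫ x, influence ν p₁ q₁ p₂ q₂ x ∂ν)) hae
  -- Both ramps vanish at `max q₁ q₂`, so the constant value must be `0`.
  have hzero := hEq (show max q₁ q₂ ∈ Ici 0 from (hp₁.trans hpq₁.le).trans (le_max_left _ _))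
  simp only [influence, ramp_of_ge hpq₁.le (le_max_left q₁ q₂),
    ramp_of_ge hpq₂.le (le_max_right q₁ q₂), mul_zero, sub_zero] at hzero
  have hk : ∀ {p q : ℝ}, 0 ≤ p → p < q →
      0 < ((cdf ν q - cdf ν p) * qcMean ν (cdf ν p) (cdf ν q))⁻¹ := fun {p q} hp hpq =>
    inv_pos.2 (mul_pos (sub_pos.2 (h.strictMonoOn hp (hp.trans hpq.le) hpq)) (h.qcMean_pos hp hpq))
  have key : EqOn (fun x => ((cdf ν q₁ - cdf ν p₁) * qcMean ν (cdf ν p₁) (cdf ν q₁))⁻¹ *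
      ramp p₁ q₁ x) (fun x => ((cdf ν q₂ - cdf ν p₂) * qcMean ν (cdf ν p₂) (cdf ν q₂))⁻¹ *
      ramp p₂ q₂ x) (Ici 0) := fun x hx => by
    have := hEq hx
    simp only [influence] at this
    rw [← hzero] at this
    simp only
    linarith
  obtain ⟨e1, e2⟩ := ramp_linear_injective hp₁ hpq₁ hp₂ hpq₂ (hk hp₁ hpq₁) (hk hp₂ hpq₂) key
  obtain ⟨e3, e4⟩ := ramp_linear_injective hp₂ hpq₂ hp₁ hpq₁ (hk hp₂ hpq₂) (hk hp₁ hpq₁) key.symm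
  rw [le_antisymm e1 e3, le_antisymm e2 e4]

lemma normSum_influence {p₁ q₁ p₂ q₂ : ℝ} (h₁ : p₁ ≤ q₁) (h₂ : p₂ ≤ q₂) (n : ℕ) (ω : Ω) :
    normSum ν X (influence ν p₁ q₁ p₂ q₂) n ω =
      ((cdf ν q₂ - cdf ν p₂) * qcMean ν (cdf ν p₂) (cdf ν q₂))⁻¹ * normSum ν X (ramp p₂ q₂) n ω -
      ((cdf ν q₁ - cdf ν p₁) * qcMean ν (cdf ν p₁) (cdf ν q₁))⁻¹ *
        normSum ν X (ramp p₁ q₁) n ω := by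
  have hi : ∀ {p q : ℝ}, p ≤ q → Integrable (ramp p q) ν := fun {p q} hpq =>
    (memLp_of_abs_le (continuous_ramp p q).measurable (abs_ramp_le hpq) 1).integrable le_rfl
  simp only [normSum, influence]
  rw [integral_sub ((hi h₂).const_mul _) ((hi h₁).const_mul _), integral_const_mul,
    integral_const_mul, Finset.sum_sub_distrib, ← Finset.mul_sum, ← Finset.mul_sum]
  ring

lemma tendstoInDistribution_sub (h : IsFullNonneg ν) (hX : ∀ i, HasLaw (X i) ν P)
    (hind : iIndepFun X P) {p₁ q₁ p₂ q₂ : ℝ} (hp₁ : 0 ≤ p₁) (hpq₁ : p₁ < q₁) (hp₂ : 0 ≤ p₂)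
    (hpq₂ : p₂ < q₂) :
    TendstoInDistribution (fun (n : ℕ) ω => √(n : ℝ) *
      (sampleQCMean (fun i : Fin n => X i ω) (cdf ν p₁) (cdf ν q₁) /
          qcMean ν (cdf ν p₁) (cdf ν q₁) -
        sampleQCMean (fun i : Fin n => X i ω) (cdf ν p₂) (cdf ν q₂) /
          qcMean ν (cdf ν p₂) (cdf ν q₂))) atTop (id : ℝ → ℝ) (fun _ => P)
      (gaussianReal 0 (variance (influence ν p₁ q₁ p₂ q₂) ν).toNNReal) := by
  obtain ⟨C, hC⟩ := exists_abs_influence_le ν hpq₁.le hpq₂.le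
  refine tendstoInDistribution_of_tendstoInMeasure_sub _ _ (tendstoInDistribution_normSum hX hind
    (continuous_influence ν p₁ q₁ p₂ q₂).measurable hC) ?_ fun n => ?_
  · have h1 := TendstoInMeasure.const_mul_zero (tendstoInMeasure_sampleQCMean h hX hind hp₁ hpq₁)
      (qcMean ν (cdf ν p₁) (cdf ν q₁))⁻¹
    have h2 := TendstoInMeasure.const_mul_zero (tendstoInMeasure_sampleQCMean h hX hind hp₂ hpq₂)
      (-(qcMean ν (cdf ν p₂) (cdf ν q₂))⁻¹)
    refine (TendstoInMeasure.add_zero h1 h2).congr_left fun n => .of_forall fun ω => ?_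
    have hm₁ := (h.qcMean_pos hp₁ hpq₁).ne'
    have hm₂ := (h.qcMean_pos hp₂ hpq₂).ne'
    simp only [Pi.sub_apply, normSum_influence hpq₁.le hpq₂.le, mul_inv]
    field_simp
    ring
  · exact (((aemeasurable_sampleQCMean hX _ _ n).div_const _).sub
      ((aemeasurable_sampleQCMean hX _ _ n).div_const _)).const_mul _

/-- Consistency follows on dividing the linear representation by `√n`, as its leading term is
bounded in probability. -/
lemma tendstoInMeasure_sampleQCMean_div (h : IsFullNonneg ν) (hX : ∀ i, HasLaw (X i) ν P)
    (hind : iIndepFun X P) {p q : ℝ} (hp : 0 ≤ p) (hpq : p < q) :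
    TendstoInMeasure P (fun (n : ℕ) ω =>
      sampleQCMean (fun i : Fin n => X i ω) (cdf ν p) (cdf ν q) / qcMean ν (cdf ν p) (cdf ν q))
      atTop (fun _ => 1) := by
  have hs := tendstoInMeasure_zero_of_tendsto (P := P) tendsto_inv_sqrt_natCast
  have hD := tendstoInMeasure_sampleQCMean h hX hind hp hpq
  have h1 := TendstoInMeasure.stochBdd_mul hs (stochBdd_normSum hX hind
    (continuous_ramp p q).measurable (abs_ramp_le hpq.le))
  have h2 := TendstoInMeasure.stochBdd_mul hD (A := fun n _ => (√(n : ℝ))⁻¹) (P := P) (by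
    intro ε _
    refine ⟨2, fun n => ?_⟩
    have hle : |(√(n : ℝ))⁻¹| < 2 := by
      rw [abs_of_nonneg (inv_nonneg.2 (Real.sqrt_nonneg _))]
      rcases Nat.eq_zero_or_pos n with rfl | hn
      · simp
      · have : 1 ≤ √(n : ℝ) := Real.one_le_sqrt.2 (by exact_mod_cast hn)
        linarith [inv_le_one_of_one_le₀ this]
    simp only [not_le.2 hle, ofPred_false, measure_empty, zero_le])
  have hm := (h.qcMean_pos hp hpq).ne'
  rw [tendstoInMeasure_const_iff]
  refine TendstoInMeasure.congr' ?_ EventuallyEq.rfl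
    (TendstoInMeasure.const_mul_zero (TendstoInMeasure.add_zero h2
      (TendstoInMeasure.const_mul_zero h1 (-(cdf ν q - cdf ν p)⁻¹)))
      (qcMean ν (cdf ν p) (cdf ν q))⁻¹)
  filter_upwards [eventually_gt_atTop 0] with n hn
  refine .of_forall fun ω => ?_
  have hs0 : √(n : ℝ) ≠ 0 := (Real.sqrt_pos.2 (by exact_mod_cast hn)).ne'
  simp only
  field_simp
  ring

/-- Slutsky's theorem applied to `√n (A / B - 1) = √n (A - B) · B⁻¹` with `B → 1` in probability. -/
theorem tendstoInDistribution_ratio (h : IsFullNonneg ν) (hX : ∀ i, HasLaw (X i) ν P)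
    (hind : iIndepFun X P) {p₁ q₁ p₂ q₂ : ℝ} (hp₁ : 0 ≤ p₁) (hpq₁ : p₁ < q₁) (hp₂ : 0 ≤ p₂)
    (hpq₂ : p₂ < q₂) :
    TendstoInDistribution (fun (n : ℕ) ω => √(n : ℝ) *
      (sampleQCMean (fun i : Fin n => X i ω) (cdf ν p₁) (cdf ν q₁) /
          qcMean ν (cdf ν p₁) (cdf ν q₁) /
        (sampleQCMean (fun i : Fin n => X i ω) (cdf ν p₂) (cdf ν q₂) /
          qcMean ν (cdf ν p₂) (cdf ν q₂)) - 1)) atTop (id : ℝ → ℝ) (fun _ => P)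
      (gaussianReal 0 (variance (influence ν p₁ q₁ p₂ q₂) ν).toNNReal) := by
  have hN := tendstoInDistribution_sub h hX hind hp₁ hpq₁ hp₂ hpq₂
  have hden := tendstoInMeasure_sampleQCMean_div h hX hind hp₂ hpq₂
  have hmeas₁ : ∀ n : ℕ, AEMeasurable (fun ω => sampleQCMean (fun i : Fin n => X i ω)
      (cdf ν p₁) (cdf ν q₁) / qcMean ν (cdf ν p₁) (cdf ν q₁)) P := fun n =>
    (aemeasurable_sampleQCMean hX _ _ n).div_const _
  have hmeas₂ : ∀ n : ℕ, AEMeasurable (fun ω => sampleQCMean (fun i : Fin n => X i ω)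
      (cdf ν p₂) (cdf ν q₂) / qcMean ν (cdf ν p₂) (cdf ν q₂)) P := fun n =>
    (aemeasurable_sampleQCMean hX _ _ n).div_const _
  set A : ℕ → Ω → ℝ := fun n ω => sampleQCMean (fun i : Fin n => X i ω)
      (cdf ν p₁) (cdf ν q₁) / qcMean ν (cdf ν p₁) (cdf ν q₁)
  set B : ℕ → Ω → ℝ := fun n ω => sampleQCMean (fun i : Fin n => X i ω)
      (cdf ν p₂) (cdf ν q₂) / qcMean ν (cdf ν p₂) (cdf ν q₂)
  have hmul := hN.continuous_comp_prodMk_of_tendstoInMeasure_const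
    (g := fun z : ℝ × ℝ => z.1 * z.2) (by fun_prop) (TendstoInMeasure.inv_one hden)
    (fun n => (hmeas₂ n).inv)
  simp only [id, mul_one] at hmul
  refine tendstoInDistribution_of_tendstoInMeasure_sub _ _ hmul ?_ fun n =>
    (((hmeas₁ n).div (hmeas₂ n)).sub_const 1).const_mul _
  rw [tendstoInMeasure_zero_iff]
  intro ε hε
  rw [tendstoInMeasure_const_iff, tendstoInMeasure_zero_iff] at hden
  -- The identity fails only where `B = 0`, since `A / 0 - 1 = -1` by convention. That event lies in
  -- `{1 ≤ |B - 1|}`, whose probability tends to `0`.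
  refine tendsto_of_tendsto_of_tendsto_of_le_of_le tendsto_const_nhds (hden 1 one_pos)
    (fun _ => zero_le) fun n => measure_mono fun ω hω => ?_
  simp only [mem_ofPred_eq, Pi.sub_apply] at hω ⊢
  by_cases hB : B n ω = 0
  · simp [hB]
  · exfalso
    have : √(n : ℝ) * (A n ω / B n ω - 1) - √(n : ℝ) * (A n ω - B n ω) * (B n ω)⁻¹ = 0 := by
      field_simp
      ring
    change ε ≤ |√(n : ℝ) * (A n ω / B n ω - 1) - √(n : ℝ) * (A n ω - B n ω) * (B n ω)⁻¹| at hω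
    rw [this, abs_zero] at hω
    linarith

end Asymptotics
end LevyQCM

/-! ### The main theorem: reduction to `c = 1`. -/

theorem proposition3p2 (a₁ b₁ a₂ b₂ : ℝ)
    (ha₁ : 0 ≤ a₁) (hab₁ : a₁ < b₁) (hb₁ : b₁ < 1)
    (ha₂ : 0 ≤ a₂) (hab₂ : a₂ < b₂) (hb₂ : b₂ < 1)
    (hne : (a₁, b₁) ≠ (a₂, b₂)) :
    ∃ τ : ℝ≥0, 0 < τ ∧
      ∀ (c : ℝ) (hc : 0 < c) (Ω : Type*) (_ : MeasurableSpace Ω) (P : Measure Ω)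
        (_ : IsProbabilityMeasure P) (X : ℕ → Ω → ℝ),
        (∀ i, HasLaw (X i) (LevyQCM.levyMeasure c hc) P) →
        iIndepFun X P →
        TendstoInDistribution
          (fun (n : ℕ) (ω : Ω) => LevyQCM.statO (fun i : Fin n => X i ω) a₁ b₁ a₂ b₂)
          atTop (id : ℝ → ℝ) (fun _ => P) (gaussianReal 0 (τ ^ 2)) := by
  have h := LevyQCM.isFullNonneg_levyMeasure 1 one_pos
  -- Each level is written as a value of the distribution function of `Lv(1)` at a nonnegative
  -- point, so quantiles become the parameters.
  obtain ⟨p₁, hp₁, rfl⟩ := h.exists_cdf_eq ha₁ (hab₁.trans hb₁)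
  obtain ⟨q₁, hq₁, rfl⟩ := h.exists_cdf_eq (ha₁.trans hab₁.le) hb₁
  obtain ⟨p₂, hp₂, rfl⟩ := h.exists_cdf_eq ha₂ (hab₂.trans hb₂)
  obtain ⟨q₂, hq₂, rfl⟩ := h.exists_cdf_eq (ha₂.trans hab₂.le) hb₂
  have hpq₁ := (monotone_cdf _).reflect_lt hab₁
  have hpq₂ := (monotone_cdf _).reflect_lt hab₂
  have hvar := LevyQCM.variance_influence_pos h hp₁ hpq₁ hp₂ hpq₂ (by
    rintro he
    rw [Prod.mk.injEq] at he
    exact hne (by rw [he.1, he.2]))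
  refine ⟨NNReal.sqrt (variance (LevyQCM.influence (LevyQCM.levyMeasure 1 one_pos) p₁ q₁ p₂ q₂)
    (LevyQCM.levyMeasure 1 one_pos)).toNNReal, NNReal.sqrt_pos.2 (Real.toNNReal_pos.2 hvar), ?_⟩
  intro c hc Ω _ P _ X hX hind
  rw [NNReal.sq_sqrt]
  -- The rescaled sample follows `Lv(1)` and has the same statistic, so `τ` can be fixed before `c`.
  have hX' : ∀ i, HasLaw (fun ω => c⁻¹ * X i ω) (LevyQCM.levyMeasure 1 one_pos) P := fun i =>
    HasLaw.comp (X := X i) (Y := fun x => c⁻¹ * x)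
      ⟨(measurable_const_mul _).aemeasurable, LevyQCM.map_inv_mul_levyMeasure c hc⟩ (hX i)
  have hind' : iIndepFun (fun i ω => c⁻¹ * X i ω) P :=
    hind.comp (fun _ x => c⁻¹ * x) fun _ => measurable_const_mul _
  have hmain := LevyQCM.tendstoInDistribution_ratio h hX' hind' hp₁ hpq₁ hp₂ hpq₂
  refine hmain.congr (fun n => .of_forall fun ω => ?_) EventuallyEq.rfl
  exact LevyQCM.statO_mul (fun i : Fin n => X i ω) (inv_pos.2 hc) _ _ _ _
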